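/- Let $\mathbf k$ be a field and let $\mathcal K$ be an abstract simplicial complex on the vertex set $[m]=\{1,\dots,m\}$ (a family of subsets of $[m]$ closed under passing to subsets and containing $\varnothing$ and every $\{j\}$, $j\in[m]$). For $\omega\subseteq[m]$ let $\mathcal K|_\omega=\{\sigma\in\mathcal K:\sigma\subseteq\omega\}$. Let $\mathbf k(\mathcal K)=\mathbf k[v_1,\dots,v_m]/\langle \prod_{j\in\tau}v_j : \tau\notin\mathcal K\rangle$ be the Stanley–Reisner ring; for $h\colon[m]\to\mathbb N$ write $v^h=\prod_j v_j^{h(j)}$ and $\operatorname{supp}h=\{j:h(j)\neq0\}$. Let $\alpha=\{\alpha_1,\dots,\alpha_r\}$ be a partition of $[m]$ into $r$ nonempty disjoint subsets that is nondegenerate for $\mathcal K$, i.e. the two vertices of any $1$-simplex of $\mathcal K$ belong to different $\alpha_i$. For $L\subseteq[r]$ put $\omega_L=\bigcup_{i\in L}\alpha_i$, and for $\sigma\subseteq[m]$ put $\mathrm I_\alpha(\sigma)=\{i\in[r]:\sigma\cap\alpha_i\neq\varnothing\}$. View $\mathbf k(\mathcal K)$ as a module over $\mathbf k[u_1,\dots,u_r]$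 via $u_i\mapsto\sum_{j\in\alpha_i}v_j$, and let $\Lambda_{\mathbf k}[t_1,\dots,t_r]\otimes_{\mathbf k}\mathbf k(\mathcal K)$ be its Koszul complex, where $\Lambda_{\mathbf k}[t_1,\dots,t_r]$ is the exterior algebra, the differential is the $\mathbf k(\mathcal K)$-linear antiderivation with $d(t_i)=\sum_{j\in\alpha_i}v_j$, and $t_I=t_{i_1}\cdots t_{i_s}$ ($I=\{i_1<\dots<i_s\}\subseteq[r]$) has cohomological degree $-|I|$. For $L\subseteq[r]$, the $\mathbf k$-span of the elements $t_I v^h$ with $\operatorname{supp}h\in\mathcal K$ and $\mathrm I_\alpha(\operatorname{supp}h)\cup I=L$ is a subcomplex $(\Lambda_{\mathbf k}[t_1,\dots,t_r]\otimes\mathbf k(\mathcal K))^L$, and one defines $$\mathrm{Tor}_{q,L}^{\mathbf k[u_1,\dots,u_r]}(\mathbf k,\mathbf k(\mathcal K)):=H^{-q}\big((\Lambda_{\mathbf k}[t_1,\dots,t_r]\otimes\mathbf k(\mathcal K))^L\big),\qquad q\ge 0.$$ Then for every $q\ge0$ and every $L\subseteq[r]$ there is an isomorphism of $\mathbf k$-vector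 spaces $$\mathrm{Tor}_{q,L}^{\mathbf k[u_1,\dots,u_r]}(\mathbf k,\mathbf k(\mathcal K))\;\cong\;\widetilde H^{\,|L|-q-1}(\mathcal K|_{\omega_L};\mathbf k),$$ where $\widetilde H^{*}$ is reduced simplicial cohomology, i.e. the cohomology of the simplicial cochain complex augmented by the empty simplex in degree $-1$ (so that $\widetilde H^{-1}(\{\varnothing\};\mathbf k)=\mathbf k$). -/

import Mathlib

open scoped TensorProduct

universe u

noncomputable section

namespace ColoredTor

/-! ### Cochain complexes of internally graded differential modules -/

section Graded

variable {k : Type u} [Field k] {E : Type u} [AddCommGroup E] [Module k E]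

/-- The cochain complex `⋯ → C j → C (j + 1) → ⋯` cut out of a module `E` with an endomorphism
`d` of square zero by submodules `C j` such that `d` maps `C j` into `C (j + 1)`. -/
def gradedComplex (d : E →ₗ[k] E) (C : ℤ → Submodule k E) (hdd : ∀ x, d (d x) = 0)
    (hC : ∀ j, ∀ x ∈ C j, d x ∈ C (j + 1)) : CochainComplex (ModuleCat.{u} k) ℤ where
  X j := ModuleCat.of k (C j)
  d i j := if h : i + 1 = j then
      ModuleCat.ofHom (d.restrict (fun x hx => h ▸ hC i x hx)) else 0
  shape i j h := dif_neg h
  d_comp_d' i j l hij hjl := by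
    have h1 : i + 1 = j := hij
    have h2 : j + 1 = l := hjl
    rw [dif_pos h1, dif_pos h2]
    refine ModuleCat.hom_ext (LinearMap.ext fun x => ?_)
    exact Subtype.ext (hdd x.1)

end Graded

theorem sum_sum_eq_zero_of_antisymm {ι M : Type*} [AddCommGroup M] (s : Finset ι) (f : ι → ι → M)
    (hdiag : ∀ i ∈ s, f i i = 0) (hanti : ∀ i ∈ s, ∀ j ∈ s, f i j = -f j i) :
    ∑ i ∈ s, ∑ j ∈ s, f i j = 0 := by
  classical
  rw [← Finset.sum_product']
  refine Finset.sum_involution (fun p _ => p.swap) ?_ ?_ ?_ ?_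
  · rintro ⟨i, j⟩ h
    rw [Finset.mem_product] at h
    simp [hanti i h.1 j h.2]
  · rintro ⟨i, j⟩ h hne heq
    rw [Finset.mem_product] at h
    simp only [Prod.swap_prod_mk, Prod.mk.injEq] at heq
    obtain rfl : j = i := heq.1
    exact hne (hdiag j h.1)
  · rintro ⟨i, j⟩ h
    rw [Finset.mem_product] at h ⊢
    exact ⟨h.2, h.1⟩
  · rintro ⟨i, j⟩ h
    rfl

/-! ### Simplicial complexes and reduced simplicial cohomology -/

section Simplicial

variable {V : Type}

/-- All simplices of `K`, the empty simplex included. (Mathlib lists only the nonempty ones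
in `K.faces`.) -/
def simplices (K : PreAbstractSimplicialComplex V) : Set (Finset V) := insert ∅ K.faces

theorem simplices_of_subset (K : PreAbstractSimplicialComplex V) {σ τ : Finset V}
    (hτ : τ ∈ simplices K) (h : σ ⊆ τ) : σ ∈ simplices K := by
  rcases σ.eq_empty_or_nonempty with rfl | hσ
  · exact Or.inl rfl
  · rcases hτ with rfl | hτ
    · exact absurd (Finset.subset_empty.mp h) hσ.ne_empty
    · exact Or.inr ((K.isRelLowerSet_faces hτ).2 h hσ)

/-- The full subcomplex `K|_ω`, consisting of the simplices of `K` contained in `ω`. -/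
def fullSubcomplex (K : PreAbstractSimplicialComplex V) (ω : Finset V) :
    PreAbstractSimplicialComplex V where
  faces := {σ | σ ∈ K.faces ∧ σ ⊆ ω}
  isRelLowerSet_faces := fun {_} hσ =>
    ⟨(K.isRelLowerSet_faces hσ.1).1, fun _ hts ht =>
      ⟨(K.isRelLowerSet_faces hσ.1).2 hts ht, Finset.Subset.trans hts hσ.2⟩⟩

variable [LinearOrder V]

/-- The sign `(-1)^c`, where `c` is the number of elements of `τ` that are less than `v`. -/
def vertexSign (k : Type u) [Field k] (v : V) (τ : Finset V) : k :=
  (-1) ^ (τ.filter (· < v)).card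

/-- The coboundary of the augmented (reduced) simplicial cochain complex, every simplex being
oriented by the order of the vertices. -/
def coboundary (k : Type u) [Field k] (K : PreAbstractSimplicialComplex V) :
    (simplices K → k) →ₗ[k] (simplices K → k) where
  toFun f τ := ∑ v ∈ τ.1, vertexSign k v τ.1 *
    f ⟨τ.1.erase v, simplices_of_subset K τ.2 (Finset.erase_subset v τ.1)⟩
  map_add' f g := by
    ext τ
    simp [mul_add, Finset.sum_add_distrib]
  map_smul' c f := by
    ext τ
    simp [Finset.mul_sum, mul_left_comm]

/-- The cochains of degree `j`: functions supported on the simplices of dimension `j`, that is,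
of cardinality `j + 1`. In degree `-1` there is the empty simplex. -/
def cochains (k : Type u) [Field k] (K : PreAbstractSimplicialComplex V) (j : ℤ) :
    Submodule k (simplices K → k) where
  carrier := {f | ∀ τ, (τ.1.card : ℤ) ≠ j + 1 → f τ = 0}
  zero_mem' _ _ := rfl
  add_mem' hf hg τ hτ := by simp [hf τ hτ, hg τ hτ]
  smul_mem' c f hf τ hτ := by simp [hf τ hτ]

theorem vertexSign_erase_of_lt (k : Type u) [Field k] {v w : V} (τ : Finset V) (h : w < v) :
    vertexSign k w (τ.erase v) = vertexSign k w τ := by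
  unfold vertexSign
  congr 2
  ext x
  simp only [Finset.mem_filter, Finset.mem_erase]
  exact ⟨fun hx => ⟨hx.1.2, hx.2⟩, fun hx => ⟨⟨(hx.2.trans h).ne, hx.1⟩, hx.2⟩⟩

theorem vertexSign_erase_of_gt (k : Type u) [Field k] {v w : V} (τ : Finset V) (hv : v ∈ τ)
    (h : v < w) : vertexSign k w (τ.erase v) = -vertexSign k w τ := by
  unfold vertexSign
  have h1 : (τ.erase v).filter (· < w) = (τ.filter (· < w)).erase v := by
    ext x
    simp only [Finset.mem_filter, Finset.mem_erase]
    tauto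
  have h2 : v ∈ τ.filter (· < w) := Finset.mem_filter.mpr ⟨hv, h⟩
  rw [h1, ← Finset.card_erase_add_one h2, pow_succ]
  ring

theorem coboundary_coboundary (k : Type u) [Field k] (K : PreAbstractSimplicialComplex V)
    (f : simplices K → k) : coboundary k K (coboundary k K f) = 0 := by
  ext τ
  let g : V → V → k := fun v w => if v = w then 0 else
    vertexSign k v τ.1 * (vertexSign k w (τ.1.erase v) *
      f ⟨(τ.1.erase v).erase w, simplices_of_subset K τ.2
        ((Finset.erase_subset w _).trans (Finset.erase_subset v τ.1))⟩)
  have hg : coboundary k K (coboundary k K f) τ = ∑ v ∈ τ.1, ∑ w ∈ τ.1, g v w := by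
    simp only [coboundary, LinearMap.coe_mk, AddHom.coe_mk, Finset.mul_sum]
    refine Finset.sum_congr rfl fun v hv => ?_
    rw [← Finset.add_sum_erase τ.1 (g v) hv]
    simp only [g, if_true, zero_add]
    refine Finset.sum_congr rfl fun w hw => ?_
    rw [if_neg (Finset.ne_of_mem_erase hw).symm]
  rw [hg]
  refine sum_sum_eq_zero_of_antisymm _ _ (fun v _ => if_pos rfl) fun v hv w hw => ?_
  rcases eq_or_ne v w with rfl | hvw
  · simp [g]
  · simp only [g, if_neg hvw, if_neg hvw.symm, Finset.erase_right_comm (a := w) (b := v)]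
    rcases lt_or_gt_of_ne hvw with h | h
    · rw [vertexSign_erase_of_gt k τ.1 hv h, vertexSign_erase_of_lt k τ.1 h]
      ring
    · rw [vertexSign_erase_of_gt k τ.1 hw h, vertexSign_erase_of_lt k τ.1 h]
      ring

theorem coboundary_mem_cochains (k : Type u) [Field k] (K : PreAbstractSimplicialComplex V)
    (j : ℤ) (f : simplices K → k) (hf : f ∈ cochains k K j) :
    coboundary k K f ∈ cochains k K (j + 1) := by
  intro τ hτ
  refine Finset.sum_eq_zero fun v hv => ?_
  rw [hf, mul_zero]
  intro h
  apply hτ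
  have := Finset.card_erase_add_one hv
  simp only at h
  omega

/-- The augmented simplicial cochain complex of `K` with coefficients in `k`. -/
def reducedCochainComplex (k : Type u) [Field k] (K : PreAbstractSimplicialComplex V) :
    CochainComplex (ModuleCat.{u} k) ℤ :=
  gradedComplex (coboundary k K) (cochains k K) (coboundary_coboundary k K)
    (coboundary_mem_cochains k K)

/-- The reduced simplicial cohomology `H̃^j(K; k)`, for every integer `j`. -/
def reducedCohomology (k : Type u) [Field k] (K : PreAbstractSimplicialComplex V) (j : ℤ) :
    ModuleCat.{u} k :=
  (reducedCochainComplex k K).homology j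

end Simplicial

/-! ### Stanley–Reisner rings -/

section StanleyReisner

variable {V : Type}

/-- The Stanley–Reisner ideal, generated by the squarefree monomials of the nonsimplices. -/
def stanleyReisnerIdeal (k : Type u) [Field k] (K : PreAbstractSimplicialComplex V) :
    Ideal (MvPolynomial V k) :=
  Ideal.span {p | ∃ τ : Finset V, τ ∉ simplices K ∧ p = ∏ j ∈ τ, MvPolynomial.X j}

/-- The Stanley–Reisner ring `k(K)`. -/
abbrev StanleyReisnerRing (k : Type u) [Field k] (K : PreAbstractSimplicialComplex V) : Type u :=
  MvPolynomial V k ⧸ stanleyReisnerIdeal k K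

/-- The monomial `v^h` in `k(K)`. -/
def srMonomial (k : Type u) [Field k] (K : PreAbstractSimplicialComplex V) (h : V →₀ ℕ) :
    StanleyReisnerRing k K :=
  Ideal.Quotient.mk _ (MvPolynomial.monomial h 1)

theorem srMonomial_eq_zero (k : Type u) [Field k] (K : PreAbstractSimplicialComplex V)
    (h : V →₀ ℕ) (hh : h.support ∉ simplices K) : srMonomial k K h = 0 := by
  classical
  rw [srMonomial, Ideal.Quotient.eq_zero_iff_mem, MvPolynomial.monomial_eq]
  have h1 : (∏ j ∈ h.support, (MvPolynomial.X j : MvPolynomial V k)) ∣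
      h.prod fun n e => MvPolynomial.X n ^ e :=
    Finset.prod_dvd_prod_of_dvd _ _ fun j hj =>
      dvd_pow_self _ (Finsupp.mem_support_iff.mp hj)
  exact Ideal.mul_mem_left _ _ (Ideal.mem_of_dvd _ h1 (Ideal.subset_span ⟨_, hh, rfl⟩))

end StanleyReisner

/-! ### Colorings -/

/-- A partition of `[m]` into `r` nonempty disjoint blocks, numbered by `[r]`. -/
structure VertexPartition (m r : ℕ) where
  block : Fin r → Finset (Fin m)
  nonempty : ∀ i, (block i).Nonempty
  disjoint : ∀ i i', i ≠ i' → Disjoint (block i) (block i')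
  cover : ∀ j, ∃ i, j ∈ block i

namespace VertexPartition

variable {m r : ℕ} (α : VertexPartition m r)

/-- The two vertices of any 1-simplex of `K` belong to different blocks. -/
def IsNondegenerate (K : PreAbstractSimplicialComplex (Fin m)) : Prop :=
  ∀ a b, a ≠ b → ({a, b} : Finset (Fin m)) ∈ K.faces → ∀ i, ¬(a ∈ α.block i ∧ b ∈ α.block i)

/-- The union `ω_L` of the blocks with index in `L`. -/
def blockUnion (L : Finset (Fin r)) : Finset (Fin m) := L.biUnion α.block

/-- The set of the indices of the blocks that meet `σ`. -/
def colors (σ : Finset (Fin m)) : Finset (Fin r) :=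
  Finset.univ.filter fun i => (σ ∩ α.block i).Nonempty

theorem colors_insert {i : Fin r} {j : Fin m} (hj : j ∈ α.block i) (σ : Finset (Fin m)) :
    α.colors (insert j σ) = insert i (α.colors σ) := by
  ext i'
  simp only [colors, Finset.mem_filter, Finset.mem_univ, true_and, Finset.mem_insert]
  constructor
  · rintro ⟨x, hx⟩
    rw [Finset.mem_inter, Finset.mem_insert] at hx
    rcases hx with ⟨rfl | hx, hx'⟩
    · left
      by_contra hne
      exact Finset.disjoint_left.mp (α.disjoint _ _ hne) hx' hj
    · exact Or.inr ⟨x, Finset.mem_inter.mpr ⟨hx, hx'⟩⟩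
  · rintro (rfl | ⟨x, hx⟩)
    · exact ⟨j, Finset.mem_inter.mpr ⟨Finset.mem_insert_self _ _, hj⟩⟩
    · rw [Finset.mem_inter] at hx
      exact ⟨x, Finset.mem_inter.mpr ⟨Finset.mem_insert_of_mem hx.1, hx.2⟩⟩

end VertexPartition

/-! ### The exterior algebra on `t_1, …, t_r` -/

section Exterior

variable (k : Type u) [Field k] {r : ℕ}

/-- The exterior algebra `Λ[t_1, …, t_r]`. -/
abbrev Ext (r : ℕ) : Type u := ExteriorAlgebra k (Fin r → k)

/-- The generator `t_i`. -/
def tGen (i : Fin r) : Ext k r := ExteriorAlgebra.ι k (Pi.single i 1)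

/-- The product of the `t_i` along a list. -/
def tList (l : List (Fin r)) : Ext k r := (l.map (tGen k)).prod

/-- The monomial `t_I = t_{i_1} ⋯ t_{i_s}` for `I = {i_1 < ⋯ < i_s}`. -/
def tMonomial (I : Finset (Fin r)) : Ext k r := tList k (I.sort (· ≤ ·))

/-- The contraction of `Λ[t_1, …, t_r]` by the `i`-th coordinate: the antiderivation that sends
`t_i` to `1` and the other generators to `0`. -/
def tContract (i : Fin r) : Ext k r →ₗ[k] Ext k r :=
  CliffordAlgebra.contractLeft (Q := (0 : QuadraticForm k (Fin r → k))) (LinearMap.proj i)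

theorem tContract_tGen_mul (i i' : Fin r) (x : Ext k r) :
    tContract k i (tGen k i' * x) =
      (if i = i' then (1 : k) else 0) • x - tGen k i' * tContract k i x := by
  have h := CliffordAlgebra.contractLeft_ι_mul (Q := (0 : QuadraticForm k (Fin r → k)))
    (LinearMap.proj i) (Pi.single i' 1) x
  rw [LinearMap.proj_apply, Pi.single_apply] at h
  exact h

theorem tContract_tList_of_notMem (i : Fin r) (l : List (Fin r)) (hi : i ∉ l) :
    tContract k i (tList k l) = 0 := by
  induction l with
  | nil => exact CliffordAlgebra.contractLeft_one (Q := (0 : QuadraticForm k (Fin r → k))) _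
  | cons a l ih =>
    rw [List.mem_cons, not_or] at hi
    have h : tList k (a :: l) = tGen k a * tList k l := by simp [tList]
    rw [h, tContract_tGen_mul, if_neg hi.1, ih hi.2, zero_smul, mul_zero, sub_zero]

theorem tContract_tList (i : Fin r) (l : List (Fin r)) (hl : l.Nodup) (hi : i ∈ l) :
    tContract k i (tList k l) = (-1 : k) ^ (l.idxOf i) • tList k (l.erase i) := by
  induction l with
  | nil => simp at hi
  | cons a l ih =>
    rw [List.nodup_cons] at hl
    have h : ∀ l', tList k (a :: l') = tGen k a * tList k l' := fun l' => by simp [tList]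
    rw [h, tContract_tGen_mul]
    rcases eq_or_ne i a with rfl | hne
    · rw [tContract_tList_of_notMem k i l hl.1]
      simp
    · have hi' : i ∈ l := (List.mem_cons.mp hi).resolve_left hne
      rw [ih hl.2 hi', if_neg hne, List.erase_cons_tail (by simpa using hne.symm), h,
        List.idxOf_cons_ne _ hne.symm, zero_smul, zero_sub, mul_smul_comm, pow_succ, mul_neg_one,
        neg_smul]

theorem tContract_tMonomial_of_notMem (i : Fin r) (I : Finset (Fin r)) (hi : i ∉ I) :
    tContract k i (tMonomial k I) = 0 :=
  tContract_tList_of_notMem k i _ (by simpa using hi)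

theorem tContract_tMonomial (i : Fin r) (I : Finset (Fin r)) (hi : i ∈ I) :
    tContract k i (tMonomial k I) =
      (-1 : k) ^ ((I.sort (· ≤ ·)).idxOf i) • tMonomial k (I.erase i) := by
  rw [tMonomial, tContract_tList k i _ (Finset.sort_nodup _ _) (by simpa using hi), tMonomial]
  congr 2
  refine List.Perm.eq_of_pairwise' (r := (· ≤ ·)) ?_ (Finset.pairwise_sort _ _) ?_
  · exact List.Pairwise.sublist List.erase_sublist (Finset.pairwise_sort _ _)
  · rw [List.perm_ext_iff_of_nodup ((Finset.sort_nodup _ _).erase _) (Finset.sort_nodup _ _)]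
    intro x
    rw [(Finset.sort_nodup _ _).mem_erase_iff]
    simp

end Exterior

/-! ### The Koszul complex and its multigrading -/

section Koszul

variable (k : Type u) [Field k] {m r : ℕ} (K : PreAbstractSimplicialComplex (Fin m))
  (α : VertexPartition m r)

/-- The homomorphism `k[u_1, …, u_r] → k(K)`, `u_i ↦ ∑_{j ∈ α_i} v_j`, through which `k(K)` is
a module over `k[u_1, …, u_r]`. -/
def paramHom : MvPolynomial (Fin r) k →ₐ[k] StanleyReisnerRing k K :=
  MvPolynomial.aeval fun i =>
    ∑ j ∈ α.block i, Ideal.Quotient.mk (stanleyReisnerIdeal k K) (MvPolynomial.X j)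

/-- The action of a polynomial of `k[u_1, …, u_r]` on the module `k(K)`: multiplication by its
image under `paramHom`. -/
def paramAction (p : MvPolynomial (Fin r) k) :
    StanleyReisnerRing k K →ₗ[k] StanleyReisnerRing k K :=
  LinearMap.mulLeft k (paramHom k K α p)

theorem paramAction_apply (p : MvPolynomial (Fin r) k) (x : StanleyReisnerRing k K) :
    paramAction k K α p x = paramHom k K α p * x := rfl

/-- The underlying module `Λ[t_1, …, t_r] ⊗ k(K)` of the Koszul complex. -/
abbrev Koszul (r : ℕ) : Type u := Ext k r ⊗[k] StanleyReisnerRing k K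

/-- The Koszul differential, the `k(K)`-linear antiderivation with `d t_i = u_i · 1`. -/
def koszulD : Koszul k K r →ₗ[k] Koszul k K r :=
  ∑ i : Fin r, TensorProduct.map (tContract k i) (paramAction k K α (MvPolynomial.X i))

theorem koszulD_tmul (x : Ext k r) (a : StanleyReisnerRing k K) :
    koszulD k K α (x ⊗ₜ a) =
      ∑ i : Fin r, tContract k i x ⊗ₜ[k] (paramHom k K α (MvPolynomial.X i) * a) := by
  simp [koszulD, LinearMap.sum_apply, paramAction_apply]

theorem koszulD_koszulD (x : Koszul k K r) : koszulD k K α (koszulD k K α x) = 0 := by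
  induction x using TensorProduct.induction_on with
  | zero => simp
  | add x y hx hy => rw [map_add, map_add, hx, hy, add_zero]
  | tmul x a =>
    simp only [koszulD_tmul, map_sum]
    refine sum_sum_eq_zero_of_antisymm _ _ (fun i _ => ?_) fun i _ j _ => ?_
    · rw [tContract, CliffordAlgebra.contractLeft_contractLeft, TensorProduct.zero_tmul]
    · rw [tContract, tContract, CliffordAlgebra.contractLeft_comm, TensorProduct.neg_tmul,
        mul_left_comm]

/-- The piece of cohomological degree `j` and multidegree `L` of the Koszul complex, spanned by
the `t_I v^h` with `supp h ∈ K`, `-|I| = j` and `I_α(supp h) ∪ I = L`. -/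
def koszulPiece (L : Finset (Fin r)) (j : ℤ) : Submodule k (Koszul k K r) :=
  Submodule.span k {x | ∃ (I : Finset (Fin r)) (h : Fin m →₀ ℕ), h.support ∈ simplices K ∧
    α.colors h.support ∪ I = L ∧ -(I.card : ℤ) = j ∧ x = tMonomial k I ⊗ₜ srMonomial k K h}

theorem koszulD_mem_koszulPiece (L : Finset (Fin r)) (j : ℤ) (x : Koszul k K r)
    (hx : x ∈ koszulPiece k K α L j) : koszulD k K α x ∈ koszulPiece k K α L (j + 1) := by
  induction hx using Submodule.span_induction with
  | zero => simp
  | add x y _ _ hx hy => rw [map_add]; exact add_mem hx hy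
  | smul c x _ hx => rw [map_smul]; exact Submodule.smul_mem _ _ hx
  | mem x hx =>
    obtain ⟨I, h, -, hL, hI, rfl⟩ := hx
    rw [koszulD_tmul]
    refine Submodule.sum_mem _ fun i _ => ?_
    by_cases hi : i ∈ I
    swap
    · rw [tContract_tMonomial_of_notMem k i I hi, TensorProduct.zero_tmul]
      exact zero_mem _
    rw [tContract_tMonomial k i I hi, ← TensorProduct.smul_tmul']
    refine Submodule.smul_mem _ _ ?_
    rw [paramHom, MvPolynomial.aeval_X, Finset.sum_mul, TensorProduct.tmul_sum]
    refine Submodule.sum_mem _ fun v hv => ?_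
    have hmul : Ideal.Quotient.mk (stanleyReisnerIdeal k K) (MvPolynomial.X v) *
        srMonomial k K h = srMonomial k K (Finsupp.single v 1 + h) := by
      rw [srMonomial, srMonomial, ← map_mul, MvPolynomial.X, MvPolynomial.monomial_mul, one_mul]
    rw [hmul]
    by_cases hs : (Finsupp.single v 1 + h).support ∈ simplices K
    swap
    · rw [srMonomial_eq_zero k K _ hs, TensorProduct.tmul_zero]
      exact zero_mem _
    refine Submodule.subset_span ⟨I.erase i, _, hs, ?_, ?_, rfl⟩
    · have hsupp : (Finsupp.single v 1 + h).support = insert v h.support := by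
        ext w
        rcases eq_or_ne w v with rfl | hw
        · simp
        · simp [hw]
      rw [hsupp, α.colors_insert hv, ← hL]
      ext w
      simp only [Finset.mem_union, Finset.mem_insert, Finset.mem_erase]
      rcases eq_or_ne w i with rfl | hw
      · simp [hi]
      · simp [hw]
    · have := Finset.card_erase_add_one hi
      omega

/-- The subcomplex `(Λ[t_1, …, t_r] ⊗ k(K))^L` of the Koszul complex, with `t_I v^h` in
cohomological degree `-|I|`. -/
def koszulComplex (L : Finset (Fin r)) : CochainComplex (ModuleCat.{u} k) ℤ :=
  gradedComplex (koszulD k K α) (koszulPiece k K α L) (koszulD_koszulD k K α)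
    (koszulD_mem_koszulPiece k K α L)

/-- The multigraded piece `Tor_{q, L}` of `Tor^{k[u_1, …, u_r]}(k, k(K))`: the cohomology in
degree `-q` of the multidegree `L` part of the Koszul complex. -/
def multigradedTor (q : ℕ) (L : Finset (Fin r)) : ModuleCat.{u} k :=
  (koszulComplex k K α L).homology (-(q : ℤ))

end Koszul

end ColoredTor

end

/-!
Let `c j` be the block of the vertex `j`. The operator `t_{c j} ⊗ (division by v_j)` is a homotopy
from the identity of the Koszul complex to the projection that kills the monomials `t_I v^h` with
`h j ≥ 2`, or with `h j ≠ 0` and `c j ∈ I`. Nondegeneracy enters here: the product of two distinct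
variables of the same block vanishes in `k(K)`, so the differential only sees `v_j`. Composing these
projections over all vertices, the only monomials of multidegree `L` that survive are the
`t_{L ∖ I_α(σ)} v^σ` with `σ` a simplex of `K|_{ω_L}`. Up to sign they span a copy of the simplicial
cochain complex; contracting `t_L` successively along the colors of the vertices of `σ` gives
exactly the signs for which the Koszul differential becomes the simplicial coboundary.
-/

noncomputable section

namespace ColoredTor

section GradedModule

variable {R E : Type*} [Ring R] [AddCommGroup E] [Module R E]
  (d : E →ₗ[R] E) (C : ℤ → Submodule R E) (j : ℤ)

/-- The cocycles of degree `j` of the graded differential module `(E, d, C)`. -/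
def gradedCycles : Submodule R E := C j ⊓ LinearMap.ker d

/-- The coboundaries of degree `j` of the graded differential module `(E, d, C)`. -/
def gradedBoundaries : Submodule R E := (C (j - 1)).map d

end GradedModule

section GradedHomology

open CategoryTheory

variable {k : Type u} [Field k] {E : Type u} [AddCommGroup E] [Module k E]
  (d : E →ₗ[k] E) (C : ℤ → Submodule k E) (hdd : ∀ x, d (d x) = 0)
  (hC : ∀ j, ∀ x ∈ C j, d x ∈ C (j + 1))

theorem gradedComplex_d_apply {i j : ℤ} (h : i + 1 = j) (x : C i) :
    (((gradedComplex d C hdd hC).d i j).hom x : C j).1 = d x.1 := by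
  subst h
  simp only [gradedComplex, dite_true]
  rfl

theorem gradedComplex_d_eq_zero_iff (j : ℤ) (x : C j) :
    ((gradedComplex d C hdd hC).d j (j + 1)).hom x = 0 ↔ d x.1 = 0 := by
  rw [← gradedComplex_d_apply d C hdd hC rfl x]
  exact Subtype.ext_iff

theorem exists_gradedComplex_d_eq_iff (j : ℤ) (x : C j) :
    (∃ y, ((gradedComplex d C hdd hC).d (j - 1) j).hom y = x) ↔
      x.1 ∈ gradedBoundaries d C j := by
  have hval := gradedComplex_d_apply d C hdd hC (sub_add_cancel j 1)
  constructor
  · rintro ⟨y, hy⟩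
    exact ⟨y.1, y.2, (hval y).symm.trans (congrArg Subtype.val hy)⟩
  · rintro ⟨y, hy, hyx⟩
    exact ⟨⟨y, hy⟩, Subtype.ext ((hval ⟨y, hy⟩).trans hyx)⟩

/-- The homology of `gradedComplex` as cocycles modulo coboundaries inside `E`. -/
def gradedHomologyEquiv (j : ℤ) :
    (gradedComplex d C hdd hC).homology j ≃ₗ[k]
      gradedCycles d C j ⧸ (gradedBoundaries d C j).submoduleOf (gradedCycles d C j) :=
  let A := gradedComplex d C hdd hC
  let S := A.sc' (j - 1) j (j + 1)
  let cyclesEquiv : LinearMap.ker S.g.hom ≃ₗ[k] gradedCycles d C j :=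
    { toFun := fun x => ⟨x.1.1, x.1.2, (gradedComplex_d_eq_zero_iff d C hdd hC j x.1).mp x.2⟩
      invFun := fun x =>
        ⟨⟨x.1, x.2.1⟩, (gradedComplex_d_eq_zero_iff d C hdd hC j ⟨x.1, x.2.1⟩).mpr x.2.2⟩
      map_add' := fun _ _ => rfl
      map_smul' := fun _ _ => rfl }
  (ShortComplex.homologyMapIso (A.isoSc' (j - 1) j (j + 1) (by simp) (by simp)) ≪≫
      S.moduleCatHomologyIso).toLinearEquiv ≪≫ₗ
    Submodule.Quotient.equiv (LinearMap.range S.moduleCatToCycles) _ cyclesEquiv (by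
      ext z
      rw [Submodule.mem_map_equiv]
      exact (exists_congr fun _ => Subtype.ext_iff).trans
        (exists_gradedComplex_d_eq_iff d C hdd hC j ⟨z.1, z.2.1⟩))

end GradedHomology

section Subquotient

variable {R M N : Type*} [Ring R] [AddCommGroup M] [Module R M] [AddCommGroup N] [Module R N]

theorem nonempty_quotient_submoduleOf_equiv {Z B : Submodule R M} {Z' B' : Submodule R N}
    (φ : N →ₗ[R] M) (hZ : ∀ z ∈ Z', φ z ∈ Z) (hB : ∀ z ∈ Z', φ z ∈ B ↔ z ∈ B')
    (hsurj : ∀ z ∈ Z, ∃ z' ∈ Z', z - φ z' ∈ B) :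
    Nonempty ((Z ⧸ B.submoduleOf Z) ≃ₗ[R] Z' ⧸ B'.submoduleOf Z') := by
  let ψ : Z' →ₗ[R] Z ⧸ B.submoduleOf Z := (B.submoduleOf Z).mkQ ∘ₗ φ.restrict hZ
  have hker : LinearMap.ker ψ = B'.submoduleOf Z' := by
    ext z
    rw [LinearMap.mem_ker]
    exact (Submodule.Quotient.mk_eq_zero _).trans (hB z.1 z.2)
  have hψ : Function.Surjective ψ := by
    intro y
    obtain ⟨⟨z, hz⟩, rfl⟩ := Submodule.mkQ_surjective _ y
    obtain ⟨z', hz', hzz'⟩ := hsurj z hz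
    exact ⟨⟨z', hz'⟩, ((Submodule.Quotient.eq (B.submoduleOf Z)).mpr hzz').symm⟩
  exact ⟨(ψ.quotKerEquivOfSurjective hψ).symm ≪≫ₗ Submodule.quotEquivOfEq _ _ hker⟩

end Subquotient

section Homotopy

variable {R E : Type*} [Ring R] [AddCommGroup E] [Module R E]

/-- `π` is homotopic to the identity of the graded differential module `(E, d, C)`. -/
def IsHomotopicToId (d : E →ₗ[R] E) (C : ℤ → Submodule R E) (π : E →ₗ[R] E) : Prop :=
  ∃ S : E →ₗ[R] E, (∀ j, ∀ x ∈ C j, S x ∈ C (j - 1)) ∧ ∀ x, π x = x - d (S x) - S (d x)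

theorem isHomotopicToId_id (d : E →ₗ[R] E) (C : ℤ → Submodule R E) :
    IsHomotopicToId d C LinearMap.id :=
  ⟨0, fun j _ _ => (C (j - 1)).zero_mem, fun x => by simp⟩

namespace IsHomotopicToId

variable {d : E →ₗ[R] E} {C : ℤ → Submodule R E} {π π' : E →ₗ[R] E}

theorem commute (h : IsHomotopicToId d C π) (hdd : ∀ x, d (d x) = 0) (x : E) :
    π (d x) = d (π x) := by
  obtain ⟨S, -, hS⟩ := h
  simp [hS, hdd]

theorem mem (h : IsHomotopicToId d C π) (hC : ∀ j, ∀ x ∈ C j, d x ∈ C (j + 1)) {j : ℤ} {x : E}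
    (hx : x ∈ C j) : π x ∈ C j := by
  obtain ⟨S, hSC, hS⟩ := h
  have hdS : d (S x) ∈ C j := by simpa using hC _ _ (hSC _ _ hx)
  have hSd : S (d x) ∈ C j := by simpa using hSC _ _ (hC _ _ hx)
  rw [hS]
  exact sub_mem (sub_mem hx hdS) hSd

theorem comp (h' : IsHomotopicToId d C π') (h : IsHomotopicToId d C π)
    (hdd : ∀ x, d (d x) = 0) (hC : ∀ j, ∀ x ∈ C j, d x ∈ C (j + 1)) :
    IsHomotopicToId d C (π' ∘ₗ π) := by
  have hcomm := h.commute hdd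
  have hmem := fun j x (hx : x ∈ C j) => h.mem hC hx
  obtain ⟨S, hSC, hS⟩ := h
  obtain ⟨S', hSC', hS'⟩ := h'
  refine ⟨S + S' ∘ₗ π, fun j x hx => add_mem (hSC _ _ hx) (hSC' _ _ (hmem _ _ hx)), fun x => ?_⟩
  simp only [LinearMap.comp_apply, LinearMap.add_apply, map_add, hcomm, hS' (π x)]
  rw [hS x]
  abel

theorem sub_mem_gradedBoundaries (h : IsHomotopicToId d C π) {j : ℤ} {x : E}
    (hx : x ∈ gradedCycles d C j) : x - π x ∈ gradedBoundaries d C j := by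
  obtain ⟨S, hSC, hS⟩ := h
  have hdx : d x = 0 := hx.2
  refine ⟨S x, hSC j x hx.1, ?_⟩
  rw [hS, hdx, map_zero]
  abel

end IsHomotopicToId

end Homotopy

section Retract

variable {k : Type u} [Field k] {E F : Type u} [AddCommGroup E] [Module k E] [AddCommGroup F]
  [Module k F]

theorem nonempty_homology_equiv_of_isHomotopicToId
    {d : E →ₗ[k] E} {C : ℤ → Submodule k E} (hdd : ∀ x, d (d x) = 0)
    (hC : ∀ j, ∀ x ∈ C j, d x ∈ C (j + 1))
    {d' : F →ₗ[k] F} {C' : ℤ → Submodule k F} (hdd' : ∀ x, d' (d' x) = 0)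
    (hC' : ∀ j, ∀ x ∈ C' j, d' x ∈ C' (j + 1))
    {φ : F →ₗ[k] E} (hφ : Function.Injective φ) (hφd : ∀ f, d (φ f) = φ (d' f)) {n : ℤ}
    (hφC : ∀ i, ∀ f ∈ C' (i + n), φ f ∈ C i)
    {π : E →ₗ[k] E} (hπ : IsHomotopicToId d C π) (hπφ : ∀ f, π (φ f) = φ f)
    (hπC : ∀ i, ∀ x ∈ C i, ∃ f ∈ C' (i + n), φ f = π x) {i j : ℤ} (hij : i + n = j) :
    Nonempty ((gradedComplex d C hdd hC).homology i ≃ₗ[k]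
      (gradedComplex d' C' hdd' hC').homology j) := by
  subst hij
  have hπd := hπ.commute hdd
  have hcycles : ∀ z ∈ gradedCycles d' C' (i + n), φ z ∈ gradedCycles d C i := fun z hz =>
    ⟨hφC i z hz.1, (hφd z).trans ((congrArg φ hz.2).trans (map_zero φ))⟩
  have hboundaries : ∀ z ∈ gradedCycles d' C' (i + n),
      φ z ∈ gradedBoundaries d C i ↔ z ∈ gradedBoundaries d' C' (i + n) := fun z _ => by
    rw [gradedBoundaries, gradedBoundaries, ← sub_add_eq_add_sub]
    constructor
    · rintro ⟨y, hy, hyz⟩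
      obtain ⟨f, hf, hfy⟩ := hπC (i - 1) y hy
      exact ⟨f, hf, hφ (by rw [← hφd, hfy, ← hπd, hyz, hπφ])⟩
    · rintro ⟨y, hy, rfl⟩
      exact ⟨φ y, hφC (i - 1) y hy, hφd y⟩
  have hsurj : ∀ z ∈ gradedCycles d C i, ∃ z' ∈ gradedCycles d' C' (i + n),
      z - φ z' ∈ gradedBoundaries d C i := fun z hz => by
    obtain ⟨f, hf, hfz⟩ := hπC i z hz.1
    refine ⟨f, ⟨hf, LinearMap.mem_ker.mpr (hφ ?_)⟩, hfz ▸ hπ.sub_mem_gradedBoundaries hz⟩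
    rw [← hφd, hfz, ← hπd, LinearMap.mem_ker.mp hz.2, map_zero, map_zero]
  obtain ⟨e⟩ := nonempty_quotient_submoduleOf_equiv φ hcycles hboundaries hsurj
  exact ⟨gradedHomologyEquiv d C hdd hC i ≪≫ₗ e ≪≫ₗ
    (gradedHomologyEquiv d' C' hdd' hC' (i + n)).symm⟩

end Retract

section OrderedProd

variable {V : Type} [LinearOrder V]

/-- The product of the `f v`, `v ∈ s`, in increasing order of the indices `v`. -/
def orderedProd {R : Type*} [Monoid R] (f : V → R) (s : Finset V) : R :=
  ((s.sort (· ≤ ·)).map f).prod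

theorem mul_prod_map_of_anticommute {R : Type*} [Ring R] {f : V → R}
    (hf : ∀ v w, f v * f w = -(f w * f v)) (v : V) {l : List V} (hl : l.Pairwise (· ≤ ·)) :
    f v * (l.map f).prod =
      (-1) ^ l.countP (· < v) * ((l.orderedInsert (· ≤ ·) v).map f).prod := by
  induction l with
  | nil => simp
  | cons w l ih =>
    rw [List.pairwise_cons] at hl
    rcases le_or_gt v w with hvw | hwv
    · have hcount : (w :: l).countP (· < v) = 0 := by
        simp only [List.countP_eq_zero, List.mem_cons, decide_eq_true_eq, not_lt]
        rintro x (rfl | hx)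
        exacts [hvw, hvw.trans (hl.1 x hx)]
      rw [hcount, List.orderedInsert_cons_of_le _ _ hvw, pow_zero, one_mul, List.map_cons (a := v),
        List.prod_cons]
    · rw [List.orderedInsert_of_not_le _ _ hwv.not_ge, List.countP_cons_of_pos (by simpa using hwv),
        List.map_cons, List.prod_cons, List.map_cons, List.prod_cons, ← mul_assoc, hf, neg_mul,
        mul_assoc, ih hl.2, ((Commute.neg_one_right (f w)).pow_right _).left_comm, pow_succ',
        neg_one_mul, neg_mul]

theorem mul_orderedProd_of_mem {R : Type*} [Ring R] {f : V → R}
    (hf : ∀ v w, f v * f w = -(f w * f v)) (hsq : ∀ v, f v * f v = 0) {v : V} {s : Finset V}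
    (hv : v ∈ s) : f v * orderedProd f s = 0 := by
  have hlist : ∀ l : List V, v ∈ l → f v * (l.map f).prod = 0 := fun l hl => by
    induction l with
    | nil => simp at hl
    | cons w l ih =>
      rw [List.map_cons, List.prod_cons, ← mul_assoc]
      rcases List.mem_cons.mp hl with rfl | hl
      · rw [hsq, zero_mul]
      · rw [hf, neg_mul, mul_assoc, ih hl, mul_zero, neg_zero]
  exact hlist _ ((Finset.mem_sort _).mpr hv)

variable (k : Type u) [Field k]

theorem vertexSign_mul_self (v : V) (s : Finset V) : vertexSign k v s * vertexSign k v s = 1 := by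
  rw [vertexSign, ← mul_pow, neg_mul_neg, one_mul, one_pow]

theorem vertexSign_insert_self (v : V) (s : Finset V) :
    vertexSign k v (insert v s) = vertexSign k v s := by
  rw [vertexSign, Finset.filter_insert, if_neg (lt_irrefl v), vertexSign]

variable {R : Type*} [Ring R] [Algebra k R] {f : V → R}

theorem mul_orderedProd_of_notMem (hf : ∀ v w, f v * f w = -(f w * f v)) {v : V} {s : Finset V}
    (hv : v ∉ s) : f v * orderedProd f s = vertexSign k v s • orderedProd f (insert v s) := by
  have hsort : (s.sort (· ≤ ·)).orderedInsert (· ≤ ·) v = (insert v s).sort (· ≤ ·) := by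
    refine List.Perm.eq_of_pairwise' (r := (· ≤ ·)) ((s.pairwise_sort _).orderedInsert v _)
      (Finset.pairwise_sort _ _) ((List.perm_orderedInsert _ _ _).trans ?_)
    rw [← Multiset.coe_eq_coe, ← Multiset.cons_coe, Finset.sort_eq, Finset.sort_eq,
      Finset.insert_val_of_notMem hv]
  have hcount : (s.sort (· ≤ ·)).countP (· < v) = (s.filter (· < v)).card := by
    rw [← Multiset.coe_countP, Finset.sort_eq, Multiset.countP_eq_card_filter]
    rfl
  rw [orderedProd, mul_prod_map_of_anticommute hf v (s.pairwise_sort _), hsort, hcount,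
    vertexSign, orderedProd, Algebra.smul_def, map_pow, map_neg, map_one]

end OrderedProd

section ExteriorAlgebra

variable (k : Type u) [Field k] {r : ℕ}

theorem tGen_mul_comm (i j : Fin r) : tGen k i * tGen k j = -(tGen k j * tGen k i) :=
  eq_neg_of_add_eq_zero_left (ExteriorAlgebra.ι_add_mul_swap _ _)

theorem tGen_mul_self (i : Fin r) : tGen k i * tGen k i = 0 := ExteriorAlgebra.ι_sq_zero _

theorem tGen_mul_tMonomial_of_mem {i : Fin r} {I : Finset (Fin r)} (hi : i ∈ I) :
    tGen k i * tMonomial k I = 0 :=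
  mul_orderedProd_of_mem (tGen_mul_comm k) (tGen_mul_self k) hi

theorem tGen_mul_tMonomial_of_notMem {i : Fin r} {I : Finset (Fin r)} (hi : i ∉ I) :
    tGen k i * tMonomial k I = vertexSign k i I • tMonomial k (insert i I) :=
  mul_orderedProd_of_notMem k (tGen_mul_comm k) hi

theorem tGen_mul_tContract_tMonomial (i : Fin r) (I : Finset (Fin r)) :
    tGen k i * tContract k i (tMonomial k I) = if i ∈ I then tMonomial k I else 0 := by
  split_ifs with hi
  · have h := tContract_tGen_mul k i i (tMonomial k I)
    rw [tGen_mul_tMonomial_of_mem k hi, map_zero, if_pos rfl, one_smul] at h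
    exact (sub_eq_zero.mp h.symm).symm
  · rw [tContract_tMonomial_of_notMem k i I hi, mul_zero]

theorem tMonomial_ne_zero (I : Finset (Fin r)) : tMonomial k I ≠ 0 := by
  induction I using Finset.induction_on with
  | empty => simp [tMonomial, tList]
  | insert i I hi ih =>
    intro h
    have hcontract := tContract_tGen_mul k i i (tMonomial k I)
    rw [tGen_mul_tMonomial_of_notMem k hi, h, smul_zero, map_zero, if_pos rfl, one_smul,
      tContract_tMonomial_of_notMem k i I hi, mul_zero, sub_zero] at hcontract
    exact ih hcontract.symm

theorem tContract_mul_comm (i j : Fin r) :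
    (tContract k i * tContract k j : Module.End k (Ext k r)) =
      -(tContract k j * tContract k i) :=
  LinearMap.ext fun x => CliffordAlgebra.contractLeft_comm _ _ x

theorem tContract_mul_self (i : Fin r) :
    (tContract k i * tContract k i : Module.End k (Ext k r)) = 0 :=
  LinearMap.ext fun x => CliffordAlgebra.contractLeft_contractLeft _ x

end ExteriorAlgebra

section ContractAlong

variable (k : Type u) [Field k] {r : ℕ} {V : Type} [LinearOrder V] (c : V → Fin r)

/-- The iterated contraction `ι_{c v₁} ∘ ⋯ ∘ ι_{c vₛ}` for `σ = {v₁ < ⋯ < vₛ}`. Since contractions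
anticommute, it carries the sign of the orientation of `σ` given by the order of its vertices. -/
def contractAlong (σ : Finset V) : Module.End k (Ext k r) :=
  orderedProd (R := Module.End k (Ext k r)) (fun v => tContract k (c v)) σ

variable {c}

theorem contractAlong_empty : contractAlong k c ∅ = 1 := by
  rw [contractAlong, orderedProd, Finset.sort_empty, List.map_nil, List.prod_nil]

theorem tContract_contractAlong_of_notMem {v : V} {σ : Finset V} (hv : v ∉ σ) (x : Ext k r) :
    tContract k (c v) (contractAlong k c σ x) =
      vertexSign k v σ • contractAlong k c (insert v σ) x :=
  LinearMap.congr_fun (mul_orderedProd_of_notMem k (R := Module.End k (Ext k r))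
    (f := fun v => tContract k (c v)) (fun v w => tContract_mul_comm k (c v) (c w)) hv) x

theorem tContract_contractAlong_of_mem {v : V} {σ : Finset V} (hv : v ∈ σ) (x : Ext k r) :
    tContract k (c v) (contractAlong k c σ x) = 0 :=
  LinearMap.congr_fun (mul_orderedProd_of_mem (R := Module.End k (Ext k r))
    (f := fun v => tContract k (c v)) (fun v w => tContract_mul_comm k (c v) (c w))
    (fun v => tContract_mul_self k (c v)) hv) x

theorem contractAlong_insert {v : V} {σ : Finset V} (hv : v ∉ σ) (x : Ext k r) :
    contractAlong k c (insert v σ) x =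
      vertexSign k v σ • tContract k (c v) (contractAlong k c σ x) := by
  rw [tContract_contractAlong_of_notMem k hv, smul_smul, vertexSign_mul_self, one_smul]

theorem tContract_contractAlong_eq_zero {i : Fin r} {x : Ext k r} (hx : tContract k i x = 0)
    (σ : Finset V) : tContract k i (contractAlong k c σ x) = 0 := by
  induction σ using Finset.induction_on with
  | empty => rwa [contractAlong_empty]
  | insert v σ hv ih =>
    rw [contractAlong_insert k hv, map_smul, ← Module.End.mul_apply, tContract_mul_comm,
      LinearMap.neg_apply, Module.End.mul_apply, ih, map_zero, neg_zero, smul_zero]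

theorem contractAlong_tMonomial_eq_zero {L : Finset (Fin r)} {σ : Finset V} {v : V} (hv : v ∈ σ)
    (hL : c v ∉ L) : contractAlong k c σ (tMonomial k L) = 0 := by
  rw [← Finset.insert_erase hv, contractAlong_insert k (Finset.notMem_erase v σ),
    tContract_contractAlong_eq_zero k (tContract_tMonomial_of_notMem k _ L hL), smul_zero]

theorem exists_contractAlong_tMonomial_eq {L : Finset (Fin r)} {σ : Finset V}
    (hc : Set.InjOn c σ) (hL : ∀ v ∈ σ, c v ∈ L) :
    ∃ a : k, a ≠ 0 ∧
      contractAlong k c σ (tMonomial k L) = a • tMonomial k (L \ σ.image c) := by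
  induction σ using Finset.induction_on with
  | empty => exact ⟨1, one_ne_zero, by simp [contractAlong_empty]⟩
  | insert v σ hv ih =>
    rw [Finset.coe_insert, Set.injOn_insert (by simpa using hv)] at hc
    rw [Finset.forall_mem_insert] at hL
    obtain ⟨a, ha, hσ⟩ := ih hc.1 hL.2
    have hmem : c v ∈ L \ σ.image c :=
      Finset.mem_sdiff.mpr ⟨hL.1, by simpa using hc.2⟩
    refine ⟨vertexSign k v σ * (a * (-1) ^ ((L \ σ.image c).sort (· ≤ ·)).idxOf (c v)), ?_, ?_⟩
    · exact mul_ne_zero (left_ne_zero_of_mul_eq_one (vertexSign_mul_self k v σ))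
        (mul_ne_zero ha (pow_ne_zero _ (neg_ne_zero.mpr one_ne_zero)))
    · rw [contractAlong_insert k hv, hσ, map_smul, tContract_tMonomial k _ _ hmem, smul_smul,
        smul_smul, mul_assoc, Finset.image_insert, Finset.sdiff_insert]

end ContractAlong

section StanleyReisnerBasis

variable {V : Type}

/-- The exponent vector of the squarefree monomial with support `σ`. -/
def indicatorExp (σ : Finset V) : V →₀ ℕ := Finsupp.indicator σ fun _ _ => 1

theorem indicatorExp_apply [DecidableEq V] (σ : Finset V) (j : V) :
    indicatorExp σ j = if j ∈ σ then 1 else 0 := by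
  rw [indicatorExp, Finsupp.indicator_apply]
  split_ifs <;> rfl

theorem support_indicatorExp (σ : Finset V) : (indicatorExp σ).support = σ := by
  classical
  ext j
  simp [indicatorExp_apply]

theorem single_add_indicatorExp [DecidableEq V] {σ : Finset V} {j : V} (hj : j ∉ σ) :
    Finsupp.single j 1 + indicatorExp σ = indicatorExp (insert j σ) := by
  ext i
  rw [Finsupp.add_apply, indicatorExp_apply, indicatorExp_apply]
  rcases eq_or_ne i j with rfl | hij
  · simp [hj]
  · simp [hij]

theorem eq_indicatorExp_of_le_one {h : V →₀ ℕ} (hh : ∀ j, h j ≤ 1) :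
    h = indicatorExp h.support := by
  classical
  ext j
  have := hh j
  rw [indicatorExp_apply]
  split_ifs with hj
  · have := Finsupp.mem_support_iff.mp hj
    omega
  · exact Finsupp.notMem_support_iff.mp hj

theorem support_single_add [DecidableEq V] (j : V) (h : V →₀ ℕ) :
    (Finsupp.single j 1 + h).support = insert j h.support := by
  rw [Finsupp.support_add_eq_union, Finsupp.support_single j one_ne_zero,
    Finset.singleton_union]

variable (k : Type u) [Field k] (K : PreAbstractSimplicialComplex V)

theorem stanleyReisnerIdeal_eq_span_monomial :
    stanleyReisnerIdeal k K = Ideal.span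
      ((fun h => MvPolynomial.monomial h (1 : k)) '' (indicatorExp '' {τ | τ ∉ simplices K})) := by
  classical
  have hprod : ∀ τ : Finset V, ∏ j ∈ τ, (MvPolynomial.X j : MvPolynomial V k) =
      MvPolynomial.monomial (indicatorExp τ) 1 := fun τ => by
    rw [MvPolynomial.monomial_eq, Finsupp.prod, support_indicatorExp, map_one, one_mul]
    refine Finset.prod_congr rfl fun j hj => ?_
    rw [indicatorExp_apply, if_pos hj, pow_one]
  rw [stanleyReisnerIdeal]
  congr 1
  ext p
  simp only [Set.mem_ofPred_eq, Set.image_image, Set.mem_image, hprod]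
  exact exists_congr fun τ => and_congr_right fun _ => eq_comm

theorem mem_stanleyReisnerIdeal_iff (p : MvPolynomial V k) :
    p ∈ stanleyReisnerIdeal k K ↔ ∀ h ∈ p.support, h.support ∉ simplices K := by
  classical
  rw [stanleyReisnerIdeal_eq_span_monomial, MvPolynomial.mem_ideal_span_monomial_image]
  refine forall₂_congr fun h _ => ⟨?_, fun hh => ⟨_, ⟨h.support, hh, rfl⟩, fun j => ?_⟩⟩
  · rintro ⟨_, ⟨τ, hτ, rfl⟩, hle⟩ hh
    refine hτ (simplices_of_subset K hh fun j hj => ?_)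
    have := hle j
    rw [indicatorExp_apply, if_pos hj] at this
    exact Finsupp.mem_support_iff.mpr (Nat.one_le_iff_ne_zero.mp this)
  · rw [indicatorExp_apply]
    split_ifs with hj
    · exact Nat.one_le_iff_ne_zero.mpr (Finsupp.mem_support_iff.mp hj)
    · exact Nat.zero_le _

variable {M : Type*} [AddCommGroup M] [Module k M]

/-- The linear map on `k(K)` with prescribed values on the monomials `v^h`. -/
def srLift (F : (V →₀ ℕ) → M) (hF : ∀ h, h.support ∉ simplices K → F h = 0) :
    StanleyReisnerRing k K →ₗ[k] M :=
  Submodule.liftQ ((stanleyReisnerIdeal k K).restrictScalars k)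
    ((MvPolynomial.basisMonomials V k).constr k F) fun p hp => by
      rw [Submodule.restrictScalars_mem, mem_stanleyReisnerIdeal_iff] at hp
      rw [LinearMap.mem_ker, Module.Basis.constr_apply]
      exact Finset.sum_eq_zero fun h hh => by simp only [hF h (hp h hh), smul_zero]

theorem srLift_srMonomial (F : (V →₀ ℕ) → M) (hF : ∀ h, h.support ∉ simplices K → F h = 0)
    (h : V →₀ ℕ) : srLift k K F hF (srMonomial k K h) = F h := by
  have hconstr := (MvPolynomial.basisMonomials V k).constr_basis k F h
  rwa [MvPolynomial.coe_basisMonomials] at hconstr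

variable {k K}

theorem srLinearMap_ext {f g : StanleyReisnerRing k K →ₗ[k] M}
    (hfg : ∀ h, f (srMonomial k K h) = g (srMonomial k K h)) : f = g := by
  refine Submodule.linearMap_qext ((stanleyReisnerIdeal k K).restrictScalars k) ?_
  exact MvPolynomial.linearMap_ext fun h => LinearMap.ext_ring (hfg h)

variable (k)

open Classical in
/-- The coefficient of `v^h` as a linear functional on `k(K)`. -/
def srCoeff {h : V →₀ ℕ} (hh : h.support ∈ simplices K) : StanleyReisnerRing k K →ₗ[k] k :=
  srLift k K (fun h' => if h' = h then 1 else 0) fun h' hh' =>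
    if_neg (by rintro rfl; exact hh' hh)

theorem srCoeff_srMonomial_self {h : V →₀ ℕ} (hh : h.support ∈ simplices K) :
    srCoeff k hh (srMonomial k K h) = 1 :=
  (srLift_srMonomial k K _ _ h).trans (if_pos rfl)

theorem srCoeff_srMonomial_of_ne {h h' : V →₀ ℕ} (hh : h.support ∈ simplices K) (hne : h' ≠ h) :
    srCoeff k hh (srMonomial k K h') = 0 :=
  (srLift_srMonomial k K _ _ h').trans (if_neg hne)

end StanleyReisnerBasis

section Division

variable (k : Type u) [Field k] {V : Type} (K : PreAbstractSimplicialComplex V)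

/-- The class of the variable `v_j` in `k(K)`. -/
def srVar (j : V) : StanleyReisnerRing k K :=
  Ideal.Quotient.mk (stanleyReisnerIdeal k K) (MvPolynomial.X j)

theorem srVar_mul_srMonomial (j : V) (h : V →₀ ℕ) :
    srVar k K j * srMonomial k K h = srMonomial k K (Finsupp.single j 1 + h) := by
  rw [srVar, srMonomial, srMonomial, ← map_mul, MvPolynomial.X, MvPolynomial.monomial_mul, one_mul]

theorem support_sub_single {h : V →₀ ℕ} {j : V} (hj : 2 ≤ h j) :
    (h - Finsupp.single j 1).support = h.support := by
  classical
  ext i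
  rw [Finsupp.mem_support_iff, Finsupp.mem_support_iff, Finsupp.tsub_apply, Finsupp.single_apply]
  split_ifs with hij
  · subst hij
    omega
  · rw [Nat.sub_zero]

/-- Division by `v_j` of the monomials divisible by `v_j ^ 2`; the other monomials are sent to `0`,
so that the support of a monomial never shrinks and the map is defined on `k(K)`. -/
def divVar (j : V) : StanleyReisnerRing k K →ₗ[k] StanleyReisnerRing k K :=
  srLift k K (fun h => if 2 ≤ h j then srMonomial k K (h - Finsupp.single j 1) else 0)
    fun h hh => by
      split_ifs with hj
      · exact srMonomial_eq_zero k K _ (by rwa [support_sub_single hj])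
      · rfl

theorem divVar_srMonomial (j : V) (h : V →₀ ℕ) :
    divVar k K j (srMonomial k K h) =
      if 2 ≤ h j then srMonomial k K (h - Finsupp.single j 1) else 0 :=
  srLift_srMonomial k K _ _ h

theorem srVar_mul_divVar_srMonomial (j : V) (h : V →₀ ℕ) :
    srVar k K j * divVar k K j (srMonomial k K h) = if 2 ≤ h j then srMonomial k K h else 0 := by
  rw [divVar_srMonomial]
  split_ifs with hj
  · rw [srVar_mul_srMonomial, add_tsub_cancel_of_le (Finsupp.single_le_iff.mpr (by omega))]
  · rw [mul_zero]

theorem divVar_srVar_mul_srMonomial (j : V) (h : V →₀ ℕ) :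
    divVar k K j (srVar k K j * srMonomial k K h) = if h j = 0 then 0 else srMonomial k K h := by
  rw [srVar_mul_srMonomial, divVar_srMonomial, add_tsub_cancel_left, Finsupp.add_apply,
    Finsupp.single_eq_same, ← ite_not]
  exact if_congr (by omega) rfl rfl

theorem divVar_srVar_mul_of_ne {i j : V} (hij : i ≠ j) (a : StanleyReisnerRing k K) :
    divVar k K j (srVar k K i * a) = srVar k K i * divVar k K j a := by
  suffices heq : divVar k K j ∘ₗ LinearMap.mulLeft k (srVar k K i) =
      LinearMap.mulLeft k (srVar k K i) ∘ₗ divVar k K j from LinearMap.congr_fun heq a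
  refine srLinearMap_ext fun h => ?_
  simp only [LinearMap.comp_apply, LinearMap.mulLeft_apply, srVar_mul_srMonomial,
    divVar_srMonomial, Finsupp.add_apply, Finsupp.single_eq_of_ne hij.symm, zero_add, mul_ite,
    mul_zero]
  refine if_ctx_congr Iff.rfl (fun hj => ?_) fun _ => rfl
  rw [add_tsub_assoc_of_le (Finsupp.single_le_iff.mpr (by omega))]

variable {K}

theorem srVar_mul_divVar_eq_zero [DecidableEq V] {i j : V} (hij : {i, j} ∉ simplices K)
    (a : StanleyReisnerRing k K) : srVar k K i * divVar k K j a = 0 := by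
  suffices heq : LinearMap.mulLeft k (srVar k K i) ∘ₗ divVar k K j = 0 from
    LinearMap.congr_fun heq a
  refine srLinearMap_ext fun h => ?_
  rw [LinearMap.comp_apply, LinearMap.mulLeft_apply, divVar_srMonomial, LinearMap.zero_apply]
  split_ifs with hj
  · have hj' : j ∈ h.support := Finsupp.mem_support_iff.mpr (by omega)
    rw [srVar_mul_srMonomial, srMonomial_eq_zero]
    rw [support_single_add, support_sub_single hj]
    exact fun hs => hij (simplices_of_subset K hs
      (Finset.insert_subset_insert i (Finset.singleton_subset_iff.mpr hj')))
  · rw [mul_zero]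

end Division

namespace VertexPartition

variable {m r : ℕ} (α : VertexPartition m r)

/-- The index of the block that contains the vertex `j`. -/
def color (j : Fin m) : Fin r := (α.cover j).choose

theorem mem_block_iff {j : Fin m} {i : Fin r} : j ∈ α.block i ↔ α.color j = i := by
  refine ⟨fun h => ?_, fun h => h ▸ (α.cover j).choose_spec⟩
  by_contra hne
  exact Finset.disjoint_left.mp (α.disjoint _ _ hne) (α.cover j).choose_spec h

theorem colors_eq_image (σ : Finset (Fin m)) : α.colors σ = σ.image α.color := by
  ext i
  simp [colors, Finset.Nonempty, mem_block_iff]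

theorem mem_blockUnion_iff {L : Finset (Fin r)} {j : Fin m} :
    j ∈ α.blockUnion L ↔ α.color j ∈ L := by
  simp [blockUnion, mem_block_iff]

variable {α} {K : PreAbstractSimplicialComplex (Fin m)}

theorem IsNondegenerate.pair_notMem_simplices (hα : α.IsNondegenerate K) {a b : Fin m}
    (hab : a ≠ b) (hc : α.color a = α.color b) : {a, b} ∉ simplices K := by
  rintro (h | h)
  · exact Finset.insert_ne_empty _ _ h
  · exact hα a b hab h (α.color b) ⟨α.mem_block_iff.mpr hc, α.mem_block_iff.mpr rfl⟩

theorem IsNondegenerate.injOn_color (hα : α.IsNondegenerate K) {σ : Finset (Fin m)}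
    (hσ : σ ∈ simplices K) : Set.InjOn α.color σ := by
  intro a ha b hb hc
  by_contra hab
  exact hα.pair_notMem_simplices hab hc (simplices_of_subset K hσ
    (Finset.insert_subset ha (Finset.singleton_subset_iff.mpr hb)))

end VertexPartition

section Contraction

variable (k : Type u) [Field k] {m r : ℕ} (K : PreAbstractSimplicialComplex (Fin m))
  (α : VertexPartition m r)

theorem paramHom_X (i : Fin r) :
    paramHom k K α (MvPolynomial.X i) = ∑ v with α.color v = i, srVar k K v := by
  rw [paramHom, MvPolynomial.aeval_X]
  refine Finset.sum_congr (Finset.ext fun v => ?_) fun _ _ => rfl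
  rw [α.mem_block_iff, Finset.mem_filter_univ]

theorem koszulD_tmul_eq_sum_srVar (x : Ext k r) (a : StanleyReisnerRing k K) :
    koszulD k K α (x ⊗ₜ a) = ∑ v, tContract k (α.color v) x ⊗ₜ[k] (srVar k K v * a) := by
  rw [koszulD_tmul, ← Finset.sum_fiberwise Finset.univ α.color]
  refine Finset.sum_congr rfl fun i _ => ?_
  rw [paramHom_X, Finset.sum_mul, TensorProduct.tmul_sum]
  refine Finset.sum_congr rfl fun v hv => ?_
  rw [Finset.mem_filter_univ] at hv
  rw [hv]

/-- The operator `t_{c(j)} ⊗ divVar j`, where `c(j)` is the color of the vertex `j`: a homotopy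
that removes the monomials `t_I v^h` which are not reduced at `j`. -/
def vertexHomotopy (j : Fin m) : Koszul k K r →ₗ[k] Koszul k K r :=
  TensorProduct.map (LinearMap.mulLeft k (tGen k (α.color j))) (divVar k K j)

theorem vertexHomotopy_tmul (j : Fin m) (x : Ext k r) (a : StanleyReisnerRing k K) :
    vertexHomotopy k K α j (x ⊗ₜ a) = (tGen k (α.color j) * x) ⊗ₜ divVar k K j a := rfl

variable {α} in
theorem koszulD_vertexHomotopy_add (hα : α.IsNondegenerate K) (j : Fin m) (x : Ext k r)
    (a : StanleyReisnerRing k K) :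
    koszulD k K α (vertexHomotopy k K α j (x ⊗ₜ a)) +
        vertexHomotopy k K α j (koszulD k K α (x ⊗ₜ a)) =
      (x - tGen k (α.color j) * tContract k (α.color j) x) ⊗ₜ
          (srVar k K j * divVar k K j a) +
        (tGen k (α.color j) * tContract k (α.color j) x) ⊗ₜ
          divVar k K j (srVar k K j * a) := by
  simp only [koszulD_tmul_eq_sum_srVar, vertexHomotopy_tmul, map_sum]
  rw [← Finset.sum_add_distrib, Finset.sum_eq_single_of_mem j (Finset.mem_univ j)]
  · rw [tContract_tGen_mul, if_pos rfl, one_smul]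
  · intro v _ hv
    rw [divVar_srVar_mul_of_ne k K hv, ← TensorProduct.add_tmul]
    by_cases hc : α.color v = α.color j
    · rw [srVar_mul_divVar_eq_zero k (hα.pair_notMem_simplices hv hc), TensorProduct.tmul_zero]
    · rw [tContract_tGen_mul, if_neg hc, zero_smul, zero_sub, neg_add_cancel,
        TensorProduct.zero_tmul]

theorem koszulPiece_le_comap_vertexHomotopy (j : Fin m) (L : Finset (Fin r)) (n : ℤ) :
    koszulPiece k K α L n ≤ (koszulPiece k K α L (n - 1)).comap (vertexHomotopy k K α j) := by
  refine Submodule.span_le.mpr ?_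
  rintro _ ⟨I, h, hh, hL, hI, rfl⟩
  rw [SetLike.mem_coe, Submodule.mem_comap, vertexHomotopy_tmul, divVar_srMonomial]
  split_ifs with hj
  swap
  · rw [TensorProduct.tmul_zero]
    exact zero_mem _
  by_cases hjI : α.color j ∈ I
  · rw [tGen_mul_tMonomial_of_mem k hjI, TensorProduct.zero_tmul]
    exact zero_mem _
  have hjh : α.color j ∈ α.colors h.support := by
    rw [α.colors_eq_image]
    exact Finset.mem_image_of_mem _ (Finsupp.mem_support_iff.mpr (by omega))
  rw [tGen_mul_tMonomial_of_notMem k hjI, ← TensorProduct.smul_tmul']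
  refine Submodule.smul_mem _ _ (Submodule.subset_span ⟨_, _, ?_, ?_, ?_, rfl⟩)
  · rwa [support_sub_single hj]
  · rw [support_sub_single hj, Finset.union_insert, hL,
      Finset.insert_eq_of_mem (hL ▸ Finset.mem_union_left _ hjh)]
  · rw [Finset.card_insert_of_notMem hjI]
    push_cast
    omega

/-- The condition on `t_I v^h` to survive the contraction along `vertexHomotopy j`. -/
def IsReducedAt (j : Fin m) (I : Finset (Fin r)) (h : Fin m →₀ ℕ) : Prop :=
  h j ≤ 1 ∧ (α.color j ∈ I → h j = 0)

variable {K α}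

open Classical in
theorem koszulD_vertexHomotopy_add_tMonomial (hα : α.IsNondegenerate K) (j : Fin m)
    (I : Finset (Fin r)) (h : Fin m →₀ ℕ) :
    koszulD k K α (vertexHomotopy k K α j (tMonomial k I ⊗ₜ srMonomial k K h)) +
        vertexHomotopy k K α j (koszulD k K α (tMonomial k I ⊗ₜ srMonomial k K h)) =
      if IsReducedAt α j I h then 0 else tMonomial k I ⊗ₜ srMonomial k K h := by
  rw [koszulD_vertexHomotopy_add k K hα, tGen_mul_tContract_tMonomial,
    srVar_mul_divVar_srMonomial, divVar_srVar_mul_srMonomial, IsReducedAt]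
  by_cases hI : α.color j ∈ I
  · have : (h j ≤ 1 ∧ h j = 0) ↔ h j = 0 := and_iff_right_of_imp fun h0 => by omega
    simp only [hI, if_true, sub_self, TensorProduct.zero_tmul, zero_add, forall_const, this]
    rw [apply_ite (tMonomial k I ⊗ₜ[k] ·), TensorProduct.tmul_zero]
  · simp only [hI, if_false, sub_zero, TensorProduct.zero_tmul, add_zero, false_implies, and_true]
    rw [apply_ite (tMonomial k I ⊗ₜ[k] ·), TensorProduct.tmul_zero, ← ite_not]
    exact if_congr (by omega) rfl rfl

variable (α) in
/-- A linear endomorphism of the Koszul complex that keeps the monomials `t_I v^h` reduced at every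
vertex of `s` and kills the others. -/
def IsReduction (s : Finset (Fin m)) (π : Koszul k K r →ₗ[k] Koszul k K r) : Prop :=
  ∀ I h, ((∀ j ∈ s, IsReducedAt α j I h) →
      π (tMonomial k I ⊗ₜ srMonomial k K h) = tMonomial k I ⊗ₜ srMonomial k K h) ∧
    ((∃ j ∈ s, ¬IsReducedAt α j I h) → π (tMonomial k I ⊗ₜ srMonomial k K h) = 0)

theorem exists_isReduction (hα : α.IsNondegenerate K) (L : Finset (Fin r))
    (s : Finset (Fin m)) :
    ∃ π, IsHomotopicToId (koszulD k K α) (koszulPiece k K α L) π ∧ IsReduction k α s π := by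
  classical
  induction s using Finset.induction_on with
  | empty => exact ⟨_, isHomotopicToId_id _ _, fun _ _ => ⟨fun _ => rfl, by simp⟩⟩
  | insert j s _ ih =>
    obtain ⟨π, hπ, hred⟩ := ih
    let π' : Koszul k K r →ₗ[k] Koszul k K r := LinearMap.id -
      koszulD k K α ∘ₗ vertexHomotopy k K α j - vertexHomotopy k K α j ∘ₗ koszulD k K α
    have hπ' : IsHomotopicToId (koszulD k K α) (koszulPiece k K α L) π' :=
      ⟨_, koszulPiece_le_comap_vertexHomotopy k K α j L, fun _ => rfl⟩
    have hπ'_apply : ∀ I h, π' (tMonomial k I ⊗ₜ srMonomial k K h) =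
        if IsReducedAt α j I h then tMonomial k I ⊗ₜ srMonomial k K h else 0 := fun I h => by
      simp only [π', LinearMap.sub_apply, LinearMap.comp_apply, LinearMap.id_apply]
      rw [sub_sub, koszulD_vertexHomotopy_add_tMonomial k hα]
      split_ifs
      exacts [sub_zero _, sub_self _]
    refine ⟨_, hπ'.comp hπ (koszulD_koszulD k K α) (koszulD_mem_koszulPiece k K α L),
      fun I h => ⟨fun hs => ?_, fun hs => ?_⟩⟩
    · rw [Finset.forall_mem_insert] at hs
      rw [LinearMap.comp_apply, (hred I h).1 hs.2, hπ'_apply, if_pos hs.1]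
    · rw [LinearMap.comp_apply]
      by_cases hs' : ∃ i ∈ s, ¬IsReducedAt α i I h
      · rw [(hred I h).2 hs', map_zero]
      · have hj : ¬IsReducedAt α j I h := by
          rw [Finset.exists_mem_insert] at hs
          exact hs.resolve_right hs'
        rw [(hred I h).1 (by push Not at hs'; exact hs'), hπ'_apply, if_neg hj]

end Contraction

section CoboundarySum

variable {V : Type}

theorem mem_simplices_fullSubcomplex {K : PreAbstractSimplicialComplex V} {ω σ : Finset V} :
    σ ∈ simplices (fullSubcomplex K ω) ↔ σ ∈ simplices K ∧ σ ⊆ ω := by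
  constructor
  · rintro (rfl | h)
    · exact ⟨Or.inl rfl, Finset.empty_subset _⟩
    · exact ⟨Or.inr h.1, h.2⟩
  · rintro ⟨rfl | h, h'⟩
    · exact Or.inl rfl
    · exact Or.inr ⟨h, h'⟩

theorem sum_sum_mem_eq_sum_sum_compl [Fintype V] [DecidableEq V] {M : Type*} [AddCommMonoid M]
    (G : Finset V → V → M) :
    ∑ τ, ∑ v ∈ τ, G τ v = ∑ σ : Finset V, ∑ v ∈ σᶜ, G (insert v σ) v := by
  rw [Finset.sum_sigma', Finset.sum_sigma']
  refine Finset.sum_bij' (fun p _ => ⟨p.1.erase p.2, p.2⟩) (fun p _ => ⟨insert p.2 p.1, p.2⟩)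
    ?_ ?_ ?_ ?_ ?_
  · simp
  · simp
  · rintro ⟨τ, v⟩ hv
    simp only [Finset.mem_sigma, Finset.mem_univ, true_and] at hv
    simp only [Finset.insert_erase hv]
  · rintro ⟨σ, v⟩ hv
    simp only [Finset.mem_sigma, Finset.mem_univ, true_and, Finset.mem_compl] at hv
    simp only [Finset.erase_insert hv]
  · rintro ⟨τ, v⟩ hv
    simp only [Finset.mem_sigma, Finset.mem_univ, true_and] at hv
    simp only [Finset.insert_erase hv]

theorem sum_coboundary_smul [LinearOrder V] [Fintype V] (k : Type u) [Field k]
    (K : PreAbstractSimplicialComplex V) [Fintype (simplices K)] {M : Type*} [AddCommGroup M]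
    [Module k M] {E : Finset V → M} (hE : ∀ τ ∉ simplices K, E τ = 0) (f : simplices K → k) :
    ∑ τ, coboundary k K f τ • E τ =
      ∑ σ, f σ • ∑ v ∈ σ.1ᶜ, vertexSign k v (insert v σ.1) • E (insert v σ.1) := by
  let F : Finset V → k := Function.extend Subtype.val f 0
  have hF : ∀ σ, F σ.1 = f σ := Subtype.val_injective.extend_apply f 0
  calc ∑ τ, coboundary k K f τ • E τ
      = ∑ τ, ∑ v ∈ τ, (vertexSign k v τ * F (τ.erase v)) • E τ := by
        refine Fintype.sum_of_injective _ Subtype.val_injective _ _ (fun τ hτ => ?_) fun τ => ?_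
        · rw [Subtype.range_coe] at hτ
          exact Finset.sum_eq_zero fun v _ => by rw [hE τ hτ, smul_zero]
        · refine Finset.sum_smul.trans (Finset.sum_congr rfl fun v _ => ?_)
          rw [← hF]
    _ = ∑ σ, F σ • ∑ v ∈ σᶜ, vertexSign k v (insert v σ) • E (insert v σ) := by
        rw [sum_sum_mem_eq_sum_sum_compl]
        refine Finset.sum_congr rfl fun σ _ => ?_
        rw [Finset.smul_sum]
        refine Finset.sum_congr rfl fun v hv => ?_
        rw [Finset.erase_insert (Finset.mem_compl.mp hv), mul_comm, mul_smul]
    _ = ∑ σ, f σ • ∑ v ∈ σ.1ᶜ, vertexSign k v (insert v σ.1) • E (insert v σ.1) := by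
        refine (Fintype.sum_of_injective _ Subtype.val_injective _ _ (fun σ hσ => ?_)
          fun σ => by rw [hF]).symm
        have hFσ : F σ = 0 := Function.extend_apply' f (0 : Finset V → k) σ hσ
        rw [hFσ, zero_smul]

end CoboundarySum

section Embedding

variable (k : Type u) [Field k] {m r : ℕ} (K : PreAbstractSimplicialComplex (Fin m))
  (α : VertexPartition m r) (L : Finset (Fin r))

/-- The image of the simplex `σ` in the Koszul complex, `± t_{L ∖ I_α(σ)} v^σ` when `σ` is a simplex
of `K|_{ω_L}`. Contracting `t_L` along the colors of `σ` produces the signs. -/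
def simplexElement (σ : Finset (Fin m)) : Koszul k K r :=
  contractAlong k α.color σ (tMonomial k L) ⊗ₜ srMonomial k K (indicatorExp σ)

variable {K α L} in
theorem simplexElement_eq_zero {σ : Finset (Fin m)}
    (hσ : σ ∉ simplices (fullSubcomplex K (α.blockUnion L))) : simplexElement k K α L σ = 0 := by
  rw [mem_simplices_fullSubcomplex, not_and_or, Finset.not_subset] at hσ
  rcases hσ with hσ | ⟨v, hv, hvL⟩
  · rw [simplexElement, srMonomial_eq_zero, TensorProduct.tmul_zero]
    rwa [support_indicatorExp]
  · rw [α.mem_blockUnion_iff] at hvL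
    rw [simplexElement, contractAlong_tMonomial_eq_zero k hv hvL, TensorProduct.zero_tmul]

theorem koszulD_simplexElement (σ : Finset (Fin m)) :
    koszulD k K α (simplexElement k K α L σ) =
      ∑ v ∈ σᶜ, vertexSign k v (insert v σ) • simplexElement k K α L (insert v σ) := by
  rw [simplexElement, koszulD_tmul_eq_sum_srVar]
  refine (Finset.sum_subset (Finset.subset_univ σᶜ) fun v _ hv => ?_).symm.trans
    (Finset.sum_congr rfl fun v hv => ?_)
  · rw [Finset.mem_compl, not_not] at hv
    rw [tContract_contractAlong_of_mem k hv, TensorProduct.zero_tmul]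
  · rw [Finset.mem_compl] at hv
    rw [tContract_contractAlong_of_notMem k hv, srVar_mul_srMonomial, single_add_indicatorExp hv,
      vertexSign_insert_self, ← TensorProduct.smul_tmul', simplexElement]

variable {K α L} in
theorem exists_simplexElement_eq_smul (hα : α.IsNondegenerate K) {σ : Finset (Fin m)}
    (hσ : σ ∈ simplices (fullSubcomplex K (α.blockUnion L))) :
    ∃ a : k, a ≠ 0 ∧ simplexElement k K α L σ =
      a • tMonomial k (L \ α.colors σ) ⊗ₜ srMonomial k K (indicatorExp σ) := by
  obtain ⟨hσK, hσL⟩ := mem_simplices_fullSubcomplex.mp hσ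
  obtain ⟨a, ha, hcontract⟩ := exists_contractAlong_tMonomial_eq k (hα.injOn_color hσK)
    fun v hv => α.mem_blockUnion_iff.mp (hσL hv)
  exact ⟨a, ha, by rw [simplexElement, hcontract, α.colors_eq_image, TensorProduct.smul_tmul']⟩

variable {K α L} in
theorem linearIndependent_simplexElement (hα : α.IsNondegenerate K) :
    LinearIndependent k fun σ : simplices (fullSubcomplex K (α.blockUnion L)) =>
      simplexElement k K α L σ := by
  classical
  refine Fintype.linearIndependent_iff.mpr fun f hf σ => ?_
  obtain ⟨a, ha, hσ⟩ := exists_simplexElement_eq_smul k hα σ.2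
  have hmem : (indicatorExp σ.1).support ∈ simplices K := by
    rw [support_indicatorExp]
    exact (mem_simplices_fullSubcomplex.mp σ.2).1
  have hcoeff := congrArg (LinearMap.lTensor (Ext k r) (srCoeff k hmem)) hf
  rw [map_sum, map_zero, Finset.sum_eq_single_of_mem σ (Finset.mem_univ σ)] at hcoeff
  · rw [hσ, map_smul, map_smul, LinearMap.lTensor_tmul, srCoeff_srMonomial_self] at hcoeff
    have hne : tMonomial k (L \ α.colors σ.1) ⊗ₜ[k] (1 : k) ≠ 0 := fun h0 =>
      tMonomial_ne_zero k _ (by simpa using congrArg (TensorProduct.rid k (Ext k r)) h0)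
    exact (smul_eq_zero.mp hcoeff).resolve_right (smul_ne_zero ha hne)
  · intro τ _ hτ
    have hne : indicatorExp τ.1 ≠ indicatorExp σ.1 := fun heq =>
      hτ (Subtype.ext (by rw [← support_indicatorExp τ.1, heq, support_indicatorExp]))
    rw [map_smul, simplexElement, LinearMap.lTensor_tmul, srCoeff_srMonomial_of_ne k hmem hne,
      TensorProduct.tmul_zero, smul_zero]

open Classical in
/-- The embedding of the simplicial cochains of `K|_{ω_L}` into the Koszul complex. -/
def cochainEmbedding :
    (simplices (fullSubcomplex K (α.blockUnion L)) → k) →ₗ[k] Koszul k K r :=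
  Fintype.linearCombination k fun σ => simplexElement k K α L σ

variable {K α L} in
theorem cochainEmbedding_injective (hα : α.IsNondegenerate K) :
    Function.Injective (cochainEmbedding k K α L) := by
  classical
  exact (linearIndependent_simplexElement k hα).fintypeLinearCombination_injective

theorem koszulD_cochainEmbedding (f : simplices (fullSubcomplex K (α.blockUnion L)) → k) :
    koszulD k K α (cochainEmbedding k K α L f) =
      cochainEmbedding k K α L (coboundary k _ f) := by
  classical
  rw [cochainEmbedding, Fintype.linearCombination_apply, Fintype.linearCombination_apply,
    sum_coboundary_smul k _ fun _ hτ => simplexElement_eq_zero k hτ, map_sum]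
  exact Finset.sum_congr rfl fun σ _ => by rw [map_smul, koszulD_simplexElement]

variable {K α L}

theorem card_sdiff_colors (hα : α.IsNondegenerate K) {σ : Finset (Fin m)}
    (hσ : σ ∈ simplices (fullSubcomplex K (α.blockUnion L))) :
    ((L \ α.colors σ).card : ℤ) = L.card - σ.card := by
  obtain ⟨hσK, hσL⟩ := mem_simplices_fullSubcomplex.mp hσ
  have hsub : σ.image α.color ⊆ L :=
    Finset.image_subset_iff.mpr fun v hv => α.mem_blockUnion_iff.mp (hσL hv)
  rw [α.colors_eq_image, Finset.cast_card_sdiff hsub,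
    Finset.card_image_of_injOn (hα.injOn_color hσK)]

theorem simplexElement_mem_koszulPiece (hα : α.IsNondegenerate K) {σ : Finset (Fin m)}
    (hσ : σ ∈ simplices (fullSubcomplex K (α.blockUnion L))) :
    simplexElement k K α L σ ∈ koszulPiece k K α L (σ.card - L.card) := by
  obtain ⟨a, -, heq⟩ := exists_simplexElement_eq_smul k hα hσ
  obtain ⟨hσK, hσL⟩ := mem_simplices_fullSubcomplex.mp hσ
  rw [heq]
  refine Submodule.smul_mem _ _ (Submodule.subset_span ⟨_, _, ?_, ?_, ?_, rfl⟩)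
  · rwa [support_indicatorExp]
  · rw [support_indicatorExp, Finset.union_sdiff_of_subset]
    rw [α.colors_eq_image]
    exact Finset.image_subset_iff.mpr fun v hv => α.mem_blockUnion_iff.mp (hσL hv)
  · rw [card_sdiff_colors hα hσ, neg_sub]

theorem cochainEmbedding_mem_koszulPiece (hα : α.IsNondegenerate K) (i : ℤ)
    (f : simplices (fullSubcomplex K (α.blockUnion L)) → k)
    (hf : f ∈ cochains k _ (i + (L.card - 1))) :
    cochainEmbedding k K α L f ∈ koszulPiece k K α L i := by
  rw [cochainEmbedding, Fintype.linearCombination_apply]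
  refine Submodule.sum_mem _ fun σ _ => ?_
  by_cases hcard : (σ.1.card : ℤ) = i + (L.card - 1) + 1
  · have hi : (σ.1.card : ℤ) - L.card = i := by omega
    exact Submodule.smul_mem _ _ (hi ▸ simplexElement_mem_koszulPiece k hα σ.2)
  · rw [hf σ hcard, zero_smul]
    exact zero_mem _

variable {k}

theorem isReducedAt_indicatorExp (j : Fin m) (σ : Finset (Fin m)) :
    IsReducedAt α j (L \ α.colors σ) (indicatorExp σ) := by
  rw [IsReducedAt, indicatorExp_apply, α.colors_eq_image]
  split_ifs with hj
  · exact ⟨le_rfl, fun h => absurd (Finset.mem_image_of_mem _ hj) (Finset.mem_sdiff.mp h).2⟩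
  · exact ⟨zero_le_one, fun _ => rfl⟩

theorem eq_of_forall_isReducedAt {I : Finset (Fin r)} {h : Fin m →₀ ℕ}
    (hr : ∀ j, IsReducedAt α j I h) (hL : α.colors h.support ∪ I = L) :
    h = indicatorExp h.support ∧ I = L \ α.colors h.support := by
  refine ⟨eq_indicatorExp_of_le_one fun j => (hr j).1, ?_⟩
  rw [← hL, Finset.union_sdiff_cancel_left]
  rw [α.colors_eq_image, Finset.disjoint_left]
  rintro _ hi hI
  obtain ⟨j, hj, rfl⟩ := Finset.mem_image.mp hi
  exact Finsupp.mem_support_iff.mp hj ((hr j).2 hI)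

theorem IsReduction.apply_cochainEmbedding (hα : α.IsNondegenerate K)
    {π : Koszul k K r →ₗ[k] Koszul k K r} (hπ : IsReduction k α Finset.univ π)
    (f : simplices (fullSubcomplex K (α.blockUnion L)) → k) :
    π (cochainEmbedding k K α L f) = cochainEmbedding k K α L f := by
  rw [cochainEmbedding, Fintype.linearCombination_apply, map_sum]
  refine Finset.sum_congr rfl fun σ _ => ?_
  obtain ⟨a, -, hσ⟩ := exists_simplexElement_eq_smul k hα σ.2
  rw [hσ, map_smul, map_smul, (hπ _ _).1 fun j _ => isReducedAt_indicatorExp j σ.1]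

theorem IsReduction.koszulPiece_le_comap (hα : α.IsNondegenerate K)
    {π : Koszul k K r →ₗ[k] Koszul k K r} (hπ : IsReduction k α Finset.univ π) (i : ℤ) :
    koszulPiece k K α L i ≤ ((cochains k _ (i + (L.card - 1))).map
      (cochainEmbedding k K α L)).comap π := by
  classical
  refine Submodule.span_le.mpr ?_
  rintro _ ⟨I, h, hh, hL, hI, rfl⟩
  rw [SetLike.mem_coe, Submodule.mem_comap]
  by_cases hr : ∀ j ∈ Finset.univ, IsReducedAt α j I h
  swap
  · rw [(hπ I h).2 (by push Not at hr; exact hr)]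
    exact zero_mem _
  obtain ⟨hh', hI'⟩ := eq_of_forall_isReducedAt (fun j => hr j (Finset.mem_univ j)) hL
  have hσ : h.support ∈ simplices (fullSubcomplex K (α.blockUnion L)) := by
    refine mem_simplices_fullSubcomplex.mpr ⟨hh, fun v hv => α.mem_blockUnion_iff.mpr ?_⟩
    rw [← hL, α.colors_eq_image]
    exact Finset.mem_union_left _ (Finset.mem_image_of_mem _ hv)
  obtain ⟨a, ha, hσ_eq⟩ := exists_simplexElement_eq_smul k hα hσ
  rw [← hI', ← hh'] at hσ_eq
  rw [(hπ I h).1 hr]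
  refine ⟨Pi.single ⟨_, hσ⟩ a⁻¹, fun τ hτ => Pi.single_eq_of_ne ?_ _, ?_⟩
  · rintro rfl
    have hcard := card_sdiff_colors hα hσ
    rw [← hI'] at hcard
    exact hτ (by simp only; omega)
  · rw [cochainEmbedding, Fintype.linearCombination_apply_single, hσ_eq, smul_smul,
      inv_mul_cancel₀ ha, one_smul]

end Embedding

end ColoredTor

end

theorem mainTheorem2_general {k : Type u} [Field k] {m r : ℕ}
    (K : PreAbstractSimplicialComplex (Fin m)) (α : ColoredTor.VertexPartition m r)
    (hα : α.IsNondegenerate K) (q : ℕ) (L : Finset (Fin r)) :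
    Nonempty (ColoredTor.multigradedTor k K α q L ≃ₗ[k]
      ColoredTor.reducedCohomology k (ColoredTor.fullSubcomplex K (α.blockUnion L))
        ((L.card : ℤ) - (q : ℤ) - 1)) := by
  obtain ⟨π, hπ, hred⟩ := ColoredTor.exists_isReduction k hα L Finset.univ
  exact ColoredTor.nonempty_homology_equiv_of_isHomotopicToId _ _ _ _
    (ColoredTor.cochainEmbedding_injective k hα) (ColoredTor.koszulD_cochainEmbedding k K α L)
    (ColoredTor.cochainEmbedding_mem_koszulPiece k hα) hπ (hred.apply_cochainEmbedding hα)
    (hred.koszulPiece_le_comap hα) (by ring)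

theorem mainTheorem2 {k : Type u} [Field k] {m r : ℕ} (K : AbstractSimplicialComplex (Fin m))
    (α : ColoredTor.VertexPartition m r)
    (hα : α.IsNondegenerate K.toPreAbstractSimplicialComplex)
    (q : ℕ) (L : Finset (Fin r)) :
    Nonempty (ColoredTor.multigradedTor k K.toPreAbstractSimplicialComplex α q L ≃ₗ[k]
      ColoredTor.reducedCohomology k
        (ColoredTor.fullSubcomplex K.toPreAbstractSimplicialComplex (α.blockUnion L))
        ((L.card : ℤ) - (q : ℤ) - 1)) :=
  mainTheorem2_general K.toPreAbstractSimplicialComplex α hα q L
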